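/- Let $2^\omega$ be the space of infinite binary sequences with the metric $d(x,y)=2^{-n}$, where $n$ is least with $x(n)\neq y(n)$ (and $d(x,x)=0$). A gauge function is a (weakly) increasing, right-continuous function $g\colon[0,\infty)\to[0,\infty)$ with $g(0)=0$ and $g(t)>0$ for $t>0$; it is of lower order than the identity if $\lim_{t\to0^+} t/g(t)=0$. For $A\subseteq 2^\omega$ let $$H^g(A)=\lim_{\delta\to0^+}\ \inf\Big\{\sum_{i=0}^\infty g(\operatorname{diam} U_i) : (U_i)_{i\in\omega}\text{ is a cover of }A\text{ by open sets of diameter}<\delta\Big\}.$$ A countable Borel equivalence relation on $2^\omega$ is an equivalence relation $E$ that is Borel as a subset of $2^\omega\times 2^\omega$ and whose classes are all countable. For a closed set $A\subseteq 2^\omega$, the restriction $E\restriction A$ is smooth if there is a Borel function $f\colon A\to\mathbb R$ such that for all $x,y\in A$, $x\mathrel E y\iff f(x)=f(y)$. Theorem 1.4. Let $E$ be a countable Borel equivalence relation on $2^\omega$. For every gauge function $g$ of lower order than the identity there is a closed set $A\subseteq 2^\omega$ such that $E\restriction A$ is smooth and $H^g(A)>0$. In particular, there is a closed set $A\subseteq2^\omega$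 of Hausdorff dimension $1$ such that $E\restriction A$ is smooth. -/

import Mathlib

open scoped NNReal ENNReal Topology

/-- The metric on the Cantor space `2^ω = (ℕ → Bool)`: `d(x, y) = 2^{-n}` where `n` is least
with `x n ≠ y n` (and `d(x, x) = 0`). Its topology is the product topology. -/
noncomputable instance cantorMetricSpace : MetricSpace (ℕ → Bool) :=
  PiNat.metricSpaceOfDiscreteUniformity (E := fun _ => Bool) fun _ => rfl

/-- The distance of two distinct points is `2^{-n}`, `n` being the first place of difference. -/
theorem cantor_dist_eq {x y : ℕ → Bool} {n : ℕ} (hn : x n ≠ y n) (h : ∀ m < n, x m = y m) :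
    dist x y = (2 : ℝ)⁻¹ ^ n := by
  have hxy : x ≠ y := fun e => hn (by rw [e])
  have h1 : dist x y = (1 / 2 : ℝ) ^ PiNat.firstDiff x y := PiNat.dist_eq_of_ne hxy
  have h2 : PiNat.firstDiff x y = n := by
    apply le_antisymm
    · by_contra hlt
      exact hn (PiNat.apply_eq_of_lt_firstDiff (not_le.1 hlt))
    · by_contra hlt
      exact PiNat.apply_firstDiff_ne hxy (h _ (not_le.1 hlt))
  rw [h1, h2, one_div]

/-- A gauge function `g : [0,∞) → [0,∞)`: (weakly) increasing, continuous on the right,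
`g 0 = 0`, and `g t > 0` for `t > 0`. -/
structure IsGauge (g : ℝ≥0 → ℝ≥0) : Prop where
  monotone : Monotone g
  right_continuous : ∀ t, ContinuousWithinAt g (Set.Ici t) t
  map_zero : g 0 = 0
  pos : ∀ t, 0 < t → 0 < g t

/-- `f ≺ g`: `f` has lower order than `g`, i.e. `g(t) / f(t) → 0` as `t → 0⁺`. -/
def LowerOrder (f g : ℝ≥0 → ℝ≥0) : Prop :=
  Filter.Tendsto (fun t => g t / f t) (𝓝[>] 0) (𝓝 0)

/-- `H^g_δ(A)`: the infimum of `∑ i, g (diam (U i))` over all countable open covers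
`(U i)` of `A` by sets of diameter `< δ`. -/
noncomputable def gaugePremeasure {X : Type*} [MetricSpace X] (g : ℝ≥0 → ℝ≥0) (δ : ℝ≥0)
    (A : Set X) : ℝ≥0∞ :=
  ⨅ (U : ℕ → Set X) (_ : ∀ i, IsOpen (U i)) (_ : ∀ i, Metric.ediam (U i) < (δ : ℝ≥0∞))
    (_ : A ⊆ ⋃ i, U i), ∑' i, (g (Metric.ediam (U i)).toNNReal : ℝ≥0∞)

/-- The `g`-measure `H^g(A) = lim_{δ → 0⁺} H^g_δ(A)`; since `H^g_δ(A)` increases as `δ`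
decreases, the limit is the supremum over `δ > 0`. -/
noncomputable def gaugeMeasure {X : Type*} [MetricSpace X] (g : ℝ≥0 → ℝ≥0) (A : Set X) : ℝ≥0∞ :=
  ⨆ (δ : ℝ≥0) (_ : 0 < δ), gaugePremeasure g δ A

/-- A countable Borel equivalence relation: Borel as a subset of `X × X`, all classes countable. -/
structure IsCountableBorel {X : Type*} [MeasurableSpace X] (E : Setoid X) : Prop where
  borel : MeasurableSet {p : X × X | E p.1 p.2}
  countable_classes : ∀ x, {y | E y x}.Countable

/-- Borel reducibility `E ≤_B F`. -/
def BorelReducible {X Y : Type*} [MeasurableSpace X] [MeasurableSpace Y]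
    (E : Setoid X) (F : Setoid Y) : Prop :=
  ∃ f : X → Y, Measurable f ∧ ∀ x₀ x₁, E x₀ x₁ ↔ F (f x₀) (f x₁)

/-- `E` is smooth if `E ≤_B =_ℝ`; here `⊥ : Setoid ℝ` is the relation of equality on `ℝ`. -/
def IsSmoothRel {X : Type*} [MeasurableSpace X] (E : Setoid X) : Prop :=
  BorelReducible E (⊥ : Setoid ℝ)

/-- The restriction `E ↾ A`, an equivalence relation on the subspace `A`. -/
def restrictRel {X : Type*} (E : Setoid X) (A : Set X) : Setoid A :=
  E.comap Subtype.val

/-! Fix a sparse infinite `D`. A matrix `M` of coin flips defines a subgroup `linearGraph D M` of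
the Cantor group, in which coordinates outside `D` are free and the others are linear functions of
them. A fixed nonzero vector lies in it with probability 0 (`measure_mem_linearGraph`). As classes
are countable, Fubini yields one `M` such that almost every `x` is equivalent to no other point of
its coset. A second use of Fubini gives a translate `a` such that almost all of the coset by `a` is
good; a compact set `A` of good points of positive mass then meets each class at most once, so a
Borel injection into `ℝ` witnesses smoothness. The mass of an `n`-cylinder is at most `2 ^ #(D ∩ [0,
n)) * 2⁻¹ ^ n`. Sparseness of `D` puts this eventually below `g (2⁻¹ ^ n)`, and the mass
distribution principle concludes. -/

open MeasureTheory Filter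

/-! ### Compact inner regularity of analytic sets -/

open Set in
theorem isCompact_box (b : ℕ → ℕ) : IsCompact {y : ℕ → ℕ | ∀ i, y i ≤ b i} := by
  have : {y : ℕ → ℕ | ∀ i, y i ≤ b i} = Set.pi univ fun i => Iic (b i) := by ext; simp [Pi.le_def]
  rw [this]
  exact isCompact_univ_pi fun i => (finite_Iic (b i)).isCompact

open MeasureTheory Set Filter in
/-- If the products `∏_{i < k} [0, b i] × ∏_{i ≥ k} ℕ` decrease to the compact box `∏ [0, b i]`
and the latter lies in an open set, then so does one of the former. -/
theorem exists_prefix_box_subset_of_box_subset {b : ℕ → ℕ} {V : Set (ℕ → ℕ)} (hV : IsOpen V)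
    (hb : {y : ℕ → ℕ | ∀ i, y i ≤ b i} ⊆ V) : ∃ k, {y : ℕ → ℕ | ∀ i < k, y i ≤ b i} ⊆ V := by
  by_contra! h
  simp only [Set.not_subset] at h
  choose y hy hyV using h
  -- Truncating at `b` moves the points into the compact box, and leaves coordinate `i` of `y k`
  -- unchanged once `k > i`.
  obtain ⟨c, hc, φ, hφ, hlim⟩ := (isCompact_box b).tendsto_subseq (x := fun k i => min (y k i) (b i))
    fun k i => min_le_right _ _
  have hlim' : Tendsto (y ∘ φ) atTop (𝓝 c) := by
    rw [tendsto_pi_nhds] at hlim ⊢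
    intro i
    refine (hlim i).congr' ?_
    filter_upwards [eventually_gt_atTop i] with k hk
    exact min_eq_left (hy (φ k) i (hk.trans_le (hφ.id_le k)))
  obtain ⟨k, hk⟩ := (hlim'.eventually (hV.mem_nhds (hb hc))).exists
  exact hyV _ hk

open MeasureTheory Set Filter in
/-- Inner regularity of analytic sets with respect to compact sets. -/
theorem MeasureTheory.AnalyticSet.exists_isCompact_le_measure {α : Type*} [TopologicalSpace α]
    [PolishSpace α] [MeasurableSpace α] [BorelSpace α] (μ : Measure α) [IsFiniteMeasure μ]
    {A : Set α} (hA : AnalyticSet A) {r : ℝ≥0∞} (hr : r < μ A) : ∃ K ⊆ A, IsCompact K ∧ r ≤ μ K := by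
  rw [AnalyticSet] at hA
  obtain rfl | ⟨f, hf, rfl⟩ := hA
  · simp at hr
  have step : ∀ (T : {T : Set (ℕ → ℕ) // r < μ (f '' T)}) (k : ℕ),
      ∃ m, r < μ (f '' (T.1 ∩ {y | y k ≤ m})) := by
    rintro ⟨T, hT⟩ k
    have hmono : Monotone fun m => f '' (T ∩ {y | y k ≤ m}) := fun m m' h =>
      image_mono (inter_subset_inter_right _ fun y (hy : y k ≤ m) => hy.trans h)
    have hU : f '' T = ⋃ m, f '' (T ∩ {y | y k ≤ m}) := by
      rw [← image_iUnion, ← inter_iUnion]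
      congr 1
      refine (inter_eq_left.2 fun y _ => mem_iUnion.2 ⟨y k, le_refl (y k)⟩).symm
    rw [hU, hmono.measure_iUnion, lt_iSup_iff] at hT
    exact hT
  choose m hm using step
  let T : ℕ → {T : Set (ℕ → ℕ) // r < μ (f '' T)} :=
    Nat.rec ⟨univ, by rwa [image_univ]⟩ fun k T => ⟨_, hm T k⟩
  let b : ℕ → ℕ := fun k => m (T k) k
  have hT : ∀ k, (T k).1 = {y | ∀ i < k, y i ≤ b i} := by
    intro k
    induction k with
    | zero => simp [T]
    | succ k ih =>
      have : (T (k + 1)).1 = (T k).1 ∩ {y | y k ≤ b k} := rfl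
      rw [this, ih]
      ext y
      simp only [mem_inter_iff, mem_ofPred_eq, Nat.forall_lt_succ_right]
  refine ⟨f '' {y | ∀ i, y i ≤ b i}, image_subset_range _ _, (isCompact_box b).image hf, ?_⟩
  -- By outer regularity, only open supersets matter; each already contains the image of some finite
  -- stage `T k`.
  rw [Set.measure_eq_iInf_isOpen]
  refine le_iInf₂ fun U hU => le_iInf fun hUo => ?_
  obtain ⟨k, hk⟩ := exists_prefix_box_subset_of_box_subset (hUo.preimage hf) (image_subset_iff.1 hU)
  rw [← hT] at hk
  exact (T k).2.le.trans (measure_mono (image_subset_iff.2 hk))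

/-! ### Coin measures and linear equations over `𝔽₂` -/

/-- The uniform probability measure on `Bool`. -/
noncomputable def fairCoin : Measure Bool := (2 : ℝ≥0∞)⁻¹ • Measure.count

theorem fairCoin_apply (s : Set Bool) : fairCoin s = 2⁻¹ * Measure.count s := rfl

theorem fairCoin_singleton (b : Bool) : fairCoin {b} = 2⁻¹ := by
  simp [fairCoin_apply]

instance : IsProbabilityMeasure fairCoin := by
  constructor
  rw [fairCoin_apply, Measure.count_univ]
  simp [ENNReal.inv_mul_cancel]

theorem fairCoin_map_add (a : Bool) : fairCoin.map (fun b => b + a) = fairCoin := by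
  refine Measure.ext_of_singleton fun b => ?_
  rw [Measure.map_apply (by fun_prop) (measurableSet_singleton b), fairCoin_singleton]
  have : (fun x => x + a) ⁻¹' {b} = {b + -a} := by
    ext x
    simp [← sub_eq_add_neg, eq_sub_iff_add_eq]
  rw [this, fairCoin_singleton]

/-- The law of a sequence of independent fair coin flips. -/
noncomputable def coinMeasure : Measure (ℕ → Bool) := Measure.infinitePi fun _ => fairCoin

instance : IsProbabilityMeasure coinMeasure := by unfold coinMeasure; infer_instance

/-- The law of a matrix of independent fair coin flips. -/
noncomputable def coinMatrixMeasure : Measure (ℕ → ℕ → Bool) :=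
  Measure.infinitePi fun _ => coinMeasure

instance : IsProbabilityMeasure coinMatrixMeasure := by unfold coinMatrixMeasure; infer_instance

theorem coinMeasure_map_add (a : ℕ → Bool) : coinMeasure.map (fun x => x + a) = coinMeasure := by
  have h := Measure.infinitePi_map_pi (μ := fun _ : ℕ => fairCoin) (f := fun i b => b + a i)
    (fun i => by fun_prop)
  simp only [fairCoin_map_add] at h
  exact h

theorem measurePreserving_add_coinMeasure (a : ℕ → Bool) :
    MeasurePreserving (fun x => x + a) coinMeasure coinMeasure :=
  ⟨by fun_prop, coinMeasure_map_add a⟩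

theorem coinMeasure_forall_mem_eq (s : Finset ℕ) (x : ℕ → Bool) :
    coinMeasure {z | ∀ i ∈ s, z i = x i} = 2⁻¹ ^ s.card := by
  have : {z : ℕ → Bool | ∀ i ∈ s, z i = x i} = Set.pi s fun i => {x i} := by ext; simp
  rw [this, coinMeasure, Measure.infinitePi_pi]
  · simp [fairCoin_singleton]
  · exact fun i _ => measurableSet_singleton _

/-- A nontrivial linear equation over `𝔽₂` holds with probability at most `1/2`. -/
theorem coinMeasure_linear_eq_le {s : Finset ℕ} {v : ℕ → Bool} {i₀ : ℕ} (hi : i₀ ∈ s)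
    (hv : v i₀ ≠ 0) (c : Bool) : coinMeasure {m | c = ∑ i ∈ s, m i * v i} ≤ 2⁻¹ := by
  have hmeas : ∀ c : Bool, MeasurableSet {m : ℕ → Bool | c = ∑ i ∈ s, m i * v i} := fun c =>
    measurableSet_eq_fun measurable_const (by fun_prop)
  have hv' : v i₀ = 1 := by revert hv; generalize v i₀ = b; revert b; decide
  -- Flipping the coin at `i₀` exchanges the disjoint events for `c` and `c + 1`, so they are
  -- equally likely.
  have hpre : (fun m : ℕ → Bool => m + Pi.single i₀ 1) ⁻¹' {m : ℕ → Bool | c = ∑ i ∈ s, m i * v i} =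
      {m : ℕ → Bool | c + 1 = ∑ i ∈ s, m i * v i} := by
    ext m
    have hb : ∀ c d : Bool, c = d + 1 ↔ c + 1 = d := by decide
    have : ∑ i ∈ s, (Pi.single i₀ 1 : ℕ → Bool) i * v i = 1 := by
      rw [Finset.sum_eq_single_of_mem i₀ hi]
      · simp [hv']
      · intro i _ hne
        simp [hne]
    simp only [Set.mem_preimage, Set.mem_ofPred_eq, Pi.add_apply, add_mul, Finset.sum_add_distrib,
      this, hb]
  have heq := (measurePreserving_add_coinMeasure (Pi.single i₀ 1)).measure_preimage
    (hmeas c).nullMeasurableSet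
  rw [hpre] at heq
  have hdisj : Disjoint {m : ℕ → Bool | c = ∑ i ∈ s, m i * v i}
      {m : ℕ → Bool | c + 1 = ∑ i ∈ s, m i * v i} := by
    rw [Set.disjoint_left]
    intro m (h1 : c = _) (h2 : c + 1 = _)
    rw [← h1] at h2
    exact (by decide : ∀ c : Bool, c + 1 ≠ c) c h2
  have hle := measure_union (μ := coinMeasure) hdisj (hmeas (c + 1)) ▸ prob_le_one
  rw [heq, ← two_mul] at hle
  rwa [ENNReal.le_inv_iff_mul_le, mul_comm]

/-! ### The random subgroup -/

open Classical in
/-- The linear equations attached to `D` and `M` determine the coordinates in `D` of a point from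
its coordinates outside `D`. -/
def linearGraph (D : Set ℕ) (M : ℕ → ℕ → Bool) : Set (ℕ → Bool) :=
  {x | ∀ n ∈ D, x n = ∑ i ∈ (Finset.range n).filter (· ∉ D), M n i * x i}

open Classical in
/-- The point of `linearGraph D M` with the same coordinates outside `D` as `z`. -/
noncomputable def linearFill (D : Set ℕ) (M : ℕ → ℕ → Bool) (z : ℕ → Bool) : ℕ → Bool := fun n =>
  if n ∈ D then ∑ i ∈ (Finset.range n).filter (· ∉ D), M n i * z i else z n

theorem linearFill_apply_of_notMem {D : Set ℕ} {n : ℕ} (hn : n ∉ D) (M : ℕ → ℕ → Bool)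
    (z : ℕ → Bool) : linearFill D M z n = z n := by
  classical exact if_neg hn

theorem linearFill_mem (D : Set ℕ) (M : ℕ → ℕ → Bool) (z : ℕ → Bool) :
    linearFill D M z ∈ linearGraph D M := by
  classical
  intro n hn
  rw [linearFill, if_pos hn]
  refine Finset.sum_congr (by congr) fun i hi => ?_
  rw [linearFill_apply_of_notMem (Finset.mem_filter.1 hi).2]

theorem measurable_linearFill (D : Set ℕ) (M : ℕ → ℕ → Bool) : Measurable (linearFill D M) := by
  classical
  refine measurable_pi_lambda _ fun n => ?_
  unfold linearFill
  split_ifs <;> fun_prop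

theorem add_mem_linearGraph {D : Set ℕ} {M : ℕ → ℕ → Bool} {x y : ℕ → Bool}
    (hx : x ∈ linearGraph D M) (hy : y ∈ linearGraph D M) : x + y ∈ linearGraph D M := by
  intro n hn
  simp only [Pi.add_apply, mul_add, Finset.sum_add_distrib]
  rw [← hx n hn, ← hy n hn]

theorem measurableSet_linearGraph_prod (D : Set ℕ) :
    MeasurableSet {p : (ℕ → ℕ → Bool) × (ℕ → Bool) | p.2 ∈ linearGraph D p.1} := by
  classical
  have : {p : (ℕ → ℕ → Bool) × (ℕ → Bool) | p.2 ∈ linearGraph D p.1} =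
      ⋂ n ∈ D, {p | p.2 n = ∑ i ∈ (Finset.range n).filter (· ∉ D), p.1 n i * p.2 i} := by
    ext p
    simp only [linearGraph, Set.mem_ofPred_eq, Set.mem_iInter]
  rw [this]
  exact MeasurableSet.biInter (Set.to_countable _) fun n _ =>
    measurableSet_eq_fun (by fun_prop) (by fun_prop)

theorem measurableSet_linearGraph (D : Set ℕ) (M : ℕ → ℕ → Bool) :
    MeasurableSet (linearGraph D M) :=
  measurable_prodMk_left (measurableSet_linearGraph_prod D)

/-- A nonzero vector almost surely avoids the random subgroup `linearGraph D M`. -/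
theorem measure_mem_linearGraph {D : Set ℕ} (hD : D.Infinite) {v : ℕ → Bool} (hv : v ≠ 0) :
    coinMatrixMeasure {M | v ∈ linearGraph D M} = 0 := by
  classical
  by_cases h : ∃ i ∉ D, v i ≠ 0
  · obtain ⟨i₀, hi₀, hvi⟩ := h
    have key : ∀ k : ℕ, coinMatrixMeasure {M | v ∈ linearGraph D M} ≤ 2⁻¹ ^ k := by
      intro k
      -- Only rows `n > i₀` involve the coordinate `i₀`; each gives an independent constraint of
      -- probability at most `1/2`.
      obtain ⟨s, hs, hk⟩ := (hD.sdiff (Set.finite_Iic i₀)).exists_subset_card_eq k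
      calc _ ≤ coinMatrixMeasure (Set.pi s fun n =>
              {m : ℕ → Bool | v n = ∑ i ∈ (Finset.range n).filter (· ∉ D), m i * v i}) :=
            measure_mono fun M (hM : v ∈ linearGraph D M) n hn => hM n (hs hn).1
        _ = ∏ n ∈ s, coinMeasure
              {m : ℕ → Bool | v n = ∑ i ∈ (Finset.range n).filter (· ∉ D), m i * v i} :=
            Measure.infinitePi_pi _ fun n _ => measurableSet_eq_fun measurable_const (by fun_prop)
        _ ≤ ∏ n ∈ s, 2⁻¹ := by
            refine Finset.prod_le_prod' fun n hn => coinMeasure_linear_eq_le (i₀ := i₀) ?_ hvi _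
            have := (hs hn).2
            simp only [Set.mem_Iic, not_le] at this
            simp [this, hi₀]
        _ = 2⁻¹ ^ k := by simp [hk]
    refine le_antisymm (ge_of_tendsto' (x := Filter.atTop) ?_ key) zero_le
    exact ENNReal.tendsto_pow_atTop_nhds_zero_of_lt_one (by simp)
  -- If `v` vanishes off `D`, the equations force it to vanish on `D` too.
  · push Not at h
    convert! measure_empty
    · ext M
      simp only [Set.mem_ofPred_eq, Set.mem_empty_iff_false, iff_false]
      intro hM
      refine hv (funext fun n => ?_)
      by_cases hn : n ∈ D
      · rw [hM n hn]
        exact Finset.sum_eq_zero fun i hi => by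
          rw [h i (by simpa using (Finset.mem_filter.1 hi).2), mul_zero]
      · exact h n hn
    · infer_instance

open Classical in
/-- `linearFill` spreads the coin measure as evenly as the free coordinates allow. -/
theorem coinMeasure_linearFill_add_le (D : Set ℕ) (M : ℕ → ℕ → Bool) (a x : ℕ → Bool) (n : ℕ) :
    coinMeasure {z | ∀ i < n, (linearFill D M z + a) i = x i} ≤
      2⁻¹ ^ ((Finset.range n).filter (· ∉ D)).card := by
  rw [← coinMeasure_forall_mem_eq _ (x + a)]
  refine measure_mono fun z hz i hi => ?_
  rw [Finset.mem_filter, Finset.mem_range] at hi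
  have := hz i hi.1
  rw [Pi.add_apply, linearFill_apply_of_notMem hi.2] at this
  rw [Pi.add_apply, ← this, add_assoc]
  generalize z i = p
  generalize a i = q
  revert p q
  decide

/-! ### A good coset and the closed set inside it -/

/-- For some `M`, almost every point is not equivalent to any other point of its coset of
`linearGraph D M`. -/
theorem exists_ae_eq_of_rel_of_add_mem_linearGraph {E : Setoid (ℕ → Bool)}
    (hE : IsCountableBorel E) {D : Set ℕ} (hD : D.Infinite) :
    ∃ M, ∀ᵐ x ∂coinMeasure, ∀ w, E w x → w + x ∈ linearGraph D M → w = x := by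
  let T : Set (((ℕ → Bool) × (ℕ → ℕ → Bool)) × (ℕ → Bool)) :=
    {p | E p.2 p.1.1 ∧ p.2 + p.1.1 ∈ linearGraph D p.1.2 ∧ p.2 ≠ p.1.1}
  have hT : MeasurableSet T := by
    have h1 : MeasurableSet {p : ((ℕ → Bool) × (ℕ → ℕ → Bool)) × (ℕ → Bool) | E p.2 p.1.1} :=
      hE.borel.preimage (f := fun p : ((ℕ → Bool) × (ℕ → ℕ → Bool)) × (ℕ → Bool) => (p.2, p.1.1))
        (by fun_prop)
    have h2 : MeasurableSet {p : ((ℕ → Bool) × (ℕ → ℕ → Bool)) × (ℕ → Bool) |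
        p.2 + p.1.1 ∈ linearGraph D p.1.2} :=
      (measurableSet_linearGraph_prod D).preimage
        (f := fun p : ((ℕ → Bool) × (ℕ → ℕ → Bool)) × (ℕ → Bool) => (p.1.2, p.2 + p.1.1))
        (by fun_prop)
    have h3 : MeasurableSet {p : ((ℕ → Bool) × (ℕ → ℕ → Bool)) × (ℕ → Bool) | p.2 = p.1.1} :=
      measurableSet_eq_fun (by fun_prop) (by fun_prop)
    exact h1.inter (h2.inter h3.compl)
  have hsec : ∀ K ⊆ Prod.fst '' T, MeasurableSet K → (coinMeasure.prod coinMatrixMeasure) K = 0 := by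
    intro K hK hKm
    rw [Measure.measure_prod_null hKm]
    refine Filter.Eventually.of_forall fun x => ?_
    have hsub : Prod.mk x ⁻¹' K ⊆ ⋃ w ∈ {w | E w x} \ {x}, {M | w + x ∈ linearGraph D M} := by
      intro M hM
      obtain ⟨⟨⟨x', M'⟩, w⟩, ⟨h1, h2, h3⟩, h⟩ := hK hM
      obtain ⟨rfl, rfl⟩ := Prod.mk.inj h
      exact Set.mem_biUnion (x := w) ⟨h1, h3⟩ h2
    refine measure_mono_null hsub ?_
    rw [measure_biUnion_null_iff ((hE.countable_classes x).mono Set.sdiff_subset)]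
    intro w hw
    refine measure_mem_linearGraph hD fun h => hw.2 ?_
    rw [add_eq_zero_iff_eq_neg] at h
    rw [Set.mem_singleton_iff, h]
    funext i
    rfl
  -- The bad pairs `(x, M)` form a projection of a Borel set, hence an analytic set; `hsec`
  -- therefore only needs to treat its compact subsets.
  have hnull : (coinMeasure.prod coinMatrixMeasure) (Prod.fst '' T) = 0 := by
    by_contra h
    obtain ⟨r, hr0, hr⟩ := exists_between (pos_iff_ne_zero.2 h)
    obtain ⟨K, hK, hKc, hle⟩ :=
      (hT.analyticSet_image measurable_fst).exists_isCompact_le_measure _ hr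
    exact (hr0.trans_le hle).ne' (hsec K hK hKc.isClosed.measurableSet)
  have hswap : ∀ᵐ p ∂coinMatrixMeasure.prod coinMeasure, p.swap ∉ Prod.fst '' T := by
    rw [← Measure.prod_swap] at hnull
    exact Measure.tendsto_ae_map measurable_swap.aemeasurable
      (measure_eq_zero_iff_ae_notMem.1 hnull)
  obtain ⟨M, hM⟩ := (Measure.ae_ae_of_ae_prod hswap).exists
  refine ⟨M, hM.mono fun x hx w hw hmem => ?_⟩
  by_contra hne
  exact hx ⟨((x, M), w), ⟨hw, hmem, hne⟩, rfl⟩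

open Classical in
/-- There is a closed set of pairwise inequivalent points supporting a measure which is spread
evenly over the coordinates outside `D`. -/
theorem exists_isClosed_measure_ne_zero {E : Setoid (ℕ → Bool)} (hE : IsCountableBorel E)
    {D : Set ℕ} (hD : D.Infinite) :
    ∃ A : Set (ℕ → Bool), IsClosed A ∧ (∀ x ∈ A, ∀ y ∈ A, E x y → x = y) ∧
      ∃ μ : Measure (ℕ → Bool), μ A ≠ 0 ∧ ∀ (x : ℕ → Bool) (n : ℕ), μ {y | ∀ i < n, y i = x i} ≤
        2⁻¹ ^ ((Finset.range n).filter (· ∉ D)).card := by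
  obtain ⟨M, hM⟩ := exists_ae_eq_of_rel_of_add_mem_linearGraph hE hD
  -- A Borel null set containing the bad points makes the exchange of `z` and `a` below legitimate.
  obtain ⟨N, hN, hNm, hN0⟩ := exists_measurable_superset_of_null (ae_iff.1 hM)
  have hNz : ∀ z, ∀ᵐ a ∂coinMeasure, linearFill D M z + a ∉ N := by
    intro z
    have h := (measurePreserving_add_coinMeasure (linearFill D M z)).quasiMeasurePreserving.ae
      (measure_eq_zero_iff_ae_notMem.1 hN0)
    simpa only [add_comm] using h
  have hmeas : Measurable fun p : (ℕ → Bool) × (ℕ → Bool) => linearFill D M p.1 + p.2 :=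
    ((measurable_linearFill D M).comp measurable_fst).add measurable_snd
  have hprod : ∀ᵐ z ∂coinMeasure, ∀ᵐ a ∂coinMeasure, linearFill D M z + a ∉ N :=
    Filter.Eventually.of_forall hNz
  obtain ⟨a, ha⟩ := ((Measure.ae_ae_comm (p := fun z a => linearFill D M z + a ∉ N) (hmeas hNm.compl)).1
    hprod).exists
  have hFa : Measurable fun z => linearFill D M z + a := (measurable_linearFill D M).add_const a
  let S : Set (ℕ → Bool) := {x | x + a ∈ linearGraph D M} ∩ Nᶜ
  have hS : MeasurableSet S :=
    ((measurableSet_linearGraph D M).preimage (measurable_id.add_const a)).inter hNm.compl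
  have haa : ∀ x : ℕ → Bool, x + a + a = x := by
    intro x
    funext i
    exact (by decide : ∀ p q : Bool, p + q + q = p) (x i) (a i)
  have hμS : coinMeasure.map (fun z => linearFill D M z + a) S = 1 := by
    rw [Measure.map_apply hFa hS, ← prob_compl_eq_zero_iff (hFa hS), ← Set.preimage_compl,
      measure_eq_zero_iff_ae_notMem]
    filter_upwards [ha] with z hz
    simp only [Set.mem_preimage, Set.mem_compl_iff, not_not]
    refine ⟨?_, hz⟩
    rw [Set.mem_ofPred_eq, haa]
    exact linearFill_mem D M z
  have : IsProbabilityMeasure (coinMeasure.map fun z => linearFill D M z + a) :=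
    Measure.isProbabilityMeasure_map hFa.aemeasurable
  obtain ⟨A, hAS, hA, hpos⟩ := hS.exists_lt_isCompact_of_ne_top
    (μ := coinMeasure.map fun z => linearFill D M z + a) (by simp [hμS]) (hμS ▸ zero_lt_one)
  refine ⟨A, hA.isClosed, fun x hx y hy hxy => ?_, _, hpos.ne', fun x n => ?_⟩
  · have hxN : x ∉ {x | ¬ ∀ w, E w x → w + x ∈ linearGraph D M → w = x} := fun h =>
      (hAS hx).2 (hN h)
    simp only [Set.mem_ofPred_eq, not_not] at hxN
    refine (hxN y (E.symm hxy) ?_).symm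
    -- In characteristic 2 the sum is the difference, so the translate cancels.
    have : y + x = y + a + (x + a) := by rw [add_add_add_comm, ← add_assoc, haa]
    rw [this]
    exact add_mem_linearGraph (hAS hy).1 (hAS hx).1
  · rw [Measure.map_apply hFa]
    · exact coinMeasure_linearFill_add_le D M a x n
    · have : {y : ℕ → Bool | ∀ i < n, y i = x i} = PiNat.cylinder x n := rfl
      rw [this]
      exact (PiNat.isOpen_cylinder _ x n).measurableSet

/-! ### Cylinders and mass distribution -/

/-- A difference at some place `≤ k` already forces distance at least `2⁻¹ ^ k`; hence `k + 1`
agreeing coordinates. -/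
theorem subset_cylinder_of_ediam_lt {U : Set (ℕ → Bool)} {x : ℕ → Bool} (hx : x ∈ U) {k : ℕ}
    (hU : Metric.ediam U < 2⁻¹ ^ k) : U ⊆ {y | ∀ i < k + 1, y i = x i} := by
  intro y hy i hi
  by_contra hne
  have hfd : ∃ n, y n ≠ x n := ⟨i, hne⟩
  classical
  have hdist := cantor_dist_eq (Nat.find_spec hfd) fun m hm => not_not.1 (Nat.find_min hfd hm)
  have hle : Nat.find hfd ≤ k := (Nat.find_min' hfd hne).trans (Nat.lt_succ_iff.1 hi)
  have h1 : edist y x < 2⁻¹ ^ k := (Metric.edist_le_ediam_of_mem hy hx).trans_lt hU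
  rw [edist_dist, hdist, ENNReal.ofReal_pow (by norm_num), ENNReal.ofReal_inv_of_pos (by norm_num)]
    at h1
  norm_num at h1
  exact absurd h1 (not_lt.2 (pow_le_pow_right_of_le_one' (by simp) hle))

theorem ediam_cylinder_le (n : ℕ) (x : ℕ → Bool) :
    Metric.ediam {y : ℕ → Bool | ∀ i < n, y i = x i} ≤ 2⁻¹ ^ n := by
  classical
  refine Metric.ediam_le fun y hy z hz => ?_
  by_cases hyz : y = z
  · simp [hyz]
  have hfd : ∃ n, y n ≠ z n := Function.ne_iff.1 hyz
  have hdist := cantor_dist_eq (Nat.find_spec hfd) fun m hm => not_not.1 (Nat.find_min hfd hm)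
  have hle : n ≤ Nat.find hfd := by
    by_contra! h
    exact Nat.find_spec hfd ((hy _ h).trans (hz _ h).symm)
  rw [edist_dist, hdist, ENNReal.ofReal_pow (by norm_num), ENNReal.ofReal_inv_of_pos (by norm_num)]
  norm_num
  exact pow_le_pow_right_of_le_one' (by simp) hle

/-- A bound for the measure of cylinders is a bound for the measure of all small sets. -/
theorem measure_le_of_ediam_le {μ : Measure (ℕ → Bool)} {f : ℝ≥0 → ℝ≥0} (hf : Monotone f)
    (hf0 : Tendsto (fun n : ℕ => f (2⁻¹ ^ n)) atTop (𝓝 0)) {N : ℕ}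
    (hμ : ∀ n ≥ N, ∀ x : ℕ → Bool, μ {y | ∀ i < n, y i = x i} ≤ f (2⁻¹ ^ n))
    {U : Set (ℕ → Bool)} (hU : Metric.ediam U ≤ 2⁻¹ ^ N) :
    μ U ≤ f (Metric.ediam U).toNNReal := by
  classical
  obtain rfl | ⟨x, hx⟩ := U.eq_empty_or_nonempty
  · simp
  obtain h0 | hpos := eq_or_ne (Metric.ediam U) 0
  · have h : μ U ≤ (0 : ℝ≥0) := by
      refine ge_of_tendsto (ENNReal.tendsto_coe.2 hf0) ?_
      filter_upwards [eventually_ge_atTop N] with n hn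
      refine (measure_mono ?_).trans (hμ n hn x)
      refine (subset_cylinder_of_ediam_lt hx (k := n) (by simp [h0, ENNReal.pow_pos])).trans ?_
      exact fun y hy i hi => hy i (hi.trans n.lt_succ_self)
    exact h.trans (by simp)
  -- For the least such `n`, minimality puts `U` in an `n`-cylinder, while `2⁻¹ ^ n` stays below the
  -- diameter, so no constant is lost.
  · have hex : ∃ n : ℕ, (2⁻¹ : ℝ≥0∞) ^ n ≤ Metric.ediam U :=
      ((ENNReal.tendsto_pow_atTop_nhds_zero_of_lt_one (by simp)).eventually
        (ge_mem_nhds (pos_iff_ne_zero.2 hpos))).exists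
    have hn := Nat.find_spec hex
    have hNn : N ≤ Nat.find hex := by
      by_contra! h
      have hle : (2⁻¹ : ℝ≥0) ^ Nat.find hex ≤ 2⁻¹ ^ N := by
        rw [← ENNReal.coe_le_coe, ENNReal.coe_pow, ENNReal.coe_pow, ENNReal.coe_inv_two]
        exact hn.trans hU
      exact absurd hle (not_le.2 (pow_lt_pow_right_of_lt_one₀ (by positivity)
        two_inv_lt_one h))
    have hsub : U ⊆ {y | ∀ i < Nat.find hex, y i = x i} := by
      rcases hk : Nat.find hex with _ | k
      · simp
      · exact subset_cylinder_of_ediam_lt hx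
          (not_le.1 (Nat.find_min hex (hk ▸ k.lt_succ_self)))
    refine (measure_mono hsub).trans ((hμ _ hNn x).trans ?_)
    refine ENNReal.coe_le_coe.2 (hf ?_)
    rw [← ENNReal.coe_le_coe, ENNReal.coe_toNNReal (ne_top_of_le_ne_top (by simp) hU)]
    rwa [ENNReal.coe_pow, ENNReal.coe_inv_two]

/-- Mass distribution principle for gauge functions. -/
theorem gaugeMeasure_pos {μ : Measure (ℕ → Bool)} {g : ℝ≥0 → ℝ≥0} (hg : IsGauge g) {N : ℕ}
    (hμ : ∀ n ≥ N, ∀ x : ℕ → Bool, μ {y | ∀ i < n, y i = x i} ≤ g (2⁻¹ ^ n))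
    {A : Set (ℕ → Bool)} (hA : μ A ≠ 0) : 0 < gaugeMeasure g A := by
  have h0 : Tendsto (fun n : ℕ => g (2⁻¹ ^ n)) atTop (𝓝 0) := by
    have h := hg.right_continuous 0
    rw [ContinuousWithinAt, hg.map_zero] at h
    refine h.comp (tendsto_nhdsWithin_iff.2 ⟨?_, by simp⟩)
    exact NNReal.tendsto_pow_atTop_nhds_zero_of_lt_one (two_inv_lt_one)
  refine (pos_iff_ne_zero.2 hA).trans_le ?_
  refine le_trans ?_ (le_iSup₂ (α := ℝ≥0∞) ((2⁻¹ : ℝ≥0) ^ N) (by positivity))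
  refine le_iInf fun U => le_iInf fun _ => le_iInf fun hU => le_iInf fun hAU => ?_
  calc μ A ≤ ∑' i, μ (U i) := (measure_mono hAU).trans (measure_iUnion_le U)
    _ ≤ _ := ENNReal.tsum_le_tsum fun i =>
      measure_le_of_ediam_le hg.monotone h0 hμ (by
        simpa only [ENNReal.coe_pow, ENNReal.coe_inv_two] using (hU i).le)

/-- Mass distribution principle for the Hausdorff dimension. -/
theorem le_dimH_of_measure_cylinder_le {μ : Measure (ℕ → Bool)} {s : ℝ≥0} (hs : 0 < s) {N : ℕ}
    (hμ : ∀ n ≥ N, ∀ x : ℕ → Bool,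
      μ {y | ∀ i < n, y i = x i} ≤ (((2⁻¹ : ℝ≥0) ^ n) ^ (s : ℝ) : ℝ≥0))
    {A : Set (ℕ → Bool)} (hA : μ A ≠ 0) : (s : ℝ≥0∞) ≤ dimH A := by
  have h0 : Tendsto (fun n : ℕ => ((2⁻¹ : ℝ≥0) ^ n) ^ (s : ℝ)) atTop (𝓝 0) := by
    have h := (NNReal.continuous_rpow_const (y := s) s.coe_nonneg).tendsto 0
    rw [NNReal.zero_rpow (by exact_mod_cast hs.ne')] at h
    exact h.comp (NNReal.tendsto_pow_atTop_nhds_zero_of_lt_one (two_inv_lt_one))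
  refine le_dimH_of_hausdorffMeasure_ne_zero fun h => hA (le_antisymm ?_ zero_le)
  rw [← h]
  refine Measure.le_hausdorffMeasure s μ (2⁻¹ ^ N) (ENNReal.pow_pos (by simp) N) (fun U hU => ?_) A
  have := measure_le_of_ediam_le (f := fun t => t ^ (s : ℝ))
    (fun a b hab => NNReal.rpow_le_rpow hab s.coe_nonneg) h0 hμ hU
  rwa [ENNReal.coe_rpow_of_nonneg _ s.coe_nonneg,
    ENNReal.coe_toNNReal (ne_top_of_le_ne_top (by simp) hU)] at this

/-- The `2 ^ n` cylinders of length `n` cover the space with diameters summing to at most 1. -/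
theorem dimH_cantor_le_one (A : Set (ℕ → Bool)) : dimH A ≤ 1 := by
  refine (dimH_mono A.subset_univ).trans ?_
  have hle : Measure.hausdorffMeasure ((1 : ℝ≥0) : ℝ) (Set.univ : Set (ℕ → Bool)) ≤ 1 := by
    have h := Measure.hausdorffMeasure_le_liminf_sum ((1 : ℝ≥0) : ℝ) (Set.univ : Set (ℕ → Bool))
      (l := atTop) (fun n : ℕ => (2⁻¹ : ℝ≥0∞) ^ n)
      (ENNReal.tendsto_pow_atTop_nhds_zero_of_lt_one (by simp))
      (ι := fun n => Fin n → Bool)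
      (fun n σ => {y : ℕ → Bool | ∀ i < n, y i = (fun i => if h : i < n then σ ⟨i, h⟩ else false) i})
      (Eventually.of_forall fun n σ => ediam_cylinder_le n _)
      (Eventually.of_forall fun n y _ => Set.mem_iUnion.2 ⟨fun i => y i, fun i hi => by simp [hi]⟩)
    refine h.trans ?_
    refine (liminf_le_liminf (v := fun _ => (1 : ℝ≥0∞)) (Eventually.of_forall fun n => ?_)).trans
      (by simp)
    calc _ ≤ ∑ _σ : Fin n → Bool, (2⁻¹ : ℝ≥0∞) ^ n := by
          refine Finset.sum_le_sum fun σ _ => ?_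
          simpa using ediam_cylinder_le n _
      _ = 1 := by
          simp [← mul_pow, ENNReal.mul_inv_cancel]
  exact_mod_cast dimH_le_of_hausdorffMeasure_ne_top (hle.trans_lt ENNReal.one_lt_top).ne

/-! ### Sparse sets and the theorem -/

open Classical in
/-- Given properties `P k` which hold eventually, there is an infinite set so sparse that
`P (#(D ∩ [0, n))) n` holds eventually. -/
theorem exists_infinite_eventually_card_filter {P : ℕ → ℕ → Prop}
    (h : ∀ k, ∀ᶠ n in atTop, P k n) :
    ∃ D : Set ℕ, D.Infinite ∧ ∀ᶠ n in atTop, P ((Finset.range n).filter (· ∈ D)).card n := by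
  -- The shift to `k + 1` matters: if `c + 1` elements of the range lie below `n`, then `n` exceeds
  -- `φ c`, from where `P (c + 1)` holds.
  obtain ⟨φ, hφ, hP⟩ := extraction_forall_of_eventually' (P := fun k N => ∀ n ≥ N, P (k + 1) n)
    fun k => by
      obtain ⟨N, hN⟩ := eventually_atTop.1 (h (k + 1))
      exact ⟨N, fun N' hN' n hn => hN n (hN'.trans hn)⟩
  refine ⟨Set.range φ, Set.infinite_range_of_injective hφ.injective, ?_⟩
  filter_upwards [eventually_gt_atTop (φ 0)] with n hn
  have hsub : ∀ k, n ≤ φ k → (Finset.range n).filter (· ∈ Set.range φ) ⊆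
      (Finset.range k).image φ := by
    intro k hk m hm
    rw [Finset.mem_filter, Finset.mem_range] at hm
    obtain ⟨hmn, j, rfl⟩ := hm
    exact Finset.mem_image_of_mem φ (Finset.mem_range.2 (hφ.lt_iff_lt.1 (hmn.trans_le hk)))
  have hpos : 0 < ((Finset.range n).filter (· ∈ Set.range φ)).card :=
    Finset.card_pos.2 ⟨φ 0, by simp [hn]⟩
  obtain ⟨c, hc⟩ := Nat.exists_eq_succ_of_ne_zero hpos.ne'
  rw [hc]
  refine hP c n ?_
  by_contra! hlt
  have := (Finset.card_le_card (hsub c hlt.le)).trans Finset.card_image_le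
  rw [hc, Finset.card_range] at this
  omega

open Classical in
theorem inv_two_pow_card_filter_notMem (D : Set ℕ) (n : ℕ) :
    (2⁻¹ : ℝ≥0∞) ^ ((Finset.range n).filter (· ∉ D)).card =
      ((2 ^ ((Finset.range n).filter (· ∈ D)).card * 2⁻¹ ^ n : ℝ≥0) : ℝ≥0∞) := by
  have hcard := Finset.card_filter_add_card_filter_not (s := Finset.range n) (· ∈ D)
  rw [Finset.card_range] at hcard
  have : (2⁻¹ : ℝ≥0) ^ ((Finset.range n).filter (· ∉ D)).card =
      2 ^ ((Finset.range n).filter (· ∈ D)).card * 2⁻¹ ^ n := by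
    conv_rhs => enter [2]; rw [← hcard]
    rw [pow_add, ← mul_assoc, ← mul_pow]
    simp
  rw [← this, ENNReal.coe_pow, ENNReal.coe_inv_two]

theorem isSmoothRel_of_pairwise_not_rel {E : Setoid (ℕ → Bool)} {A : Set (ℕ → Bool)}
    (h : ∀ x ∈ A, ∀ y ∈ A, E x y → x = y) : IsSmoothRel (restrictRel E A) := by
  obtain ⟨f, hf⟩ := exists_measurableEmbedding_real (ℕ → Bool)
  refine ⟨fun x => f x, hf.measurable.comp measurable_subtype_coe, fun x y => ?_⟩
  refine ⟨fun hxy => congrArg f (h x x.2 y y.2 hxy), fun hxy => ?_⟩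
  rw [Subtype.ext (hf.injective hxy)]

theorem theorem1p4 (E : Setoid (ℕ → Bool)) (hE : IsCountableBorel E) :
    (∀ g : ℝ≥0 → ℝ≥0, IsGauge g → LowerOrder g id →
      ∃ A : Set (ℕ → Bool), IsClosed A ∧ IsSmoothRel (restrictRel E A) ∧ 0 < gaugeMeasure g A) ∧
    (∃ A : Set (ℕ → Bool), IsClosed A ∧ IsSmoothRel (restrictRel E A) ∧ dimH A = 1) := by
  classical
  constructor
  · intro g hg hlow
    have hpow : Tendsto (fun n : ℕ => (2⁻¹ : ℝ≥0) ^ n) atTop (𝓝[>] 0) :=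
      tendsto_nhdsWithin_iff.2 ⟨NNReal.tendsto_pow_atTop_nhds_zero_of_lt_one
        (two_inv_lt_one), Eventually.of_forall fun n => by simp⟩
    have hev : ∀ k : ℕ, ∀ᶠ n : ℕ in atTop, 2 ^ k * 2⁻¹ ^ n ≤ g (2⁻¹ ^ n) := by
      intro k
      filter_upwards [(hlow.comp hpow).eventually
        (ge_mem_nhds (by positivity : (0 : ℝ≥0) < (2 ^ k)⁻¹))] with n hn
      simp only [Function.comp_apply, id_eq] at hn
      rw [div_le_iff₀ (hg.pos _ (by positivity))] at hn
      rwa [← le_inv_mul_iff₀ (by positivity)]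
    obtain ⟨D, hD, hDg⟩ := exists_infinite_eventually_card_filter hev
    obtain ⟨N, hN⟩ := eventually_atTop.1 hDg
    obtain ⟨A, hA, hAE, μ, hμA, hμ⟩ := exists_isClosed_measure_ne_zero hE hD
    refine ⟨A, hA, isSmoothRel_of_pairwise_not_rel hAE, gaugeMeasure_pos hg (N := N) ?_ hμA⟩
    intro n hn x
    refine (hμ x n).trans ?_
    rw [inv_two_pow_card_filter_notMem]
    exact ENNReal.coe_le_coe.2 (hN n hn)
  -- Cylinder masses become at most `n * 2⁻¹ ^ n`, eventually below `(2⁻¹ ^ n) ^ s` for each `s <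
  -- 1`, so one `A` serves all `s`.
  · obtain ⟨D, hD, hDn⟩ := exists_infinite_eventually_card_filter (P := fun k n => 2 ^ k ≤ n)
      fun k => eventually_ge_atTop (2 ^ k)
    obtain ⟨A, hA, hAE, μ, hμA, hμ⟩ := exists_isClosed_measure_ne_zero hE hD
    refine ⟨A, hA, isSmoothRel_of_pairwise_not_rel hAE, (dimH_cantor_le_one A).antisymm ?_⟩
    refine le_of_forall_lt fun r hr => ?_
    obtain ⟨s, hrs, hs1⟩ := ENNReal.lt_iff_exists_nnreal_btwn.1 hr
    have hs1 : s < 1 := by exact_mod_cast hs1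
    have hs0 : 0 < s := by exact_mod_cast zero_le.trans_lt hrs
    refine hrs.trans_le ?_
    have hlt : (2 : ℝ) ^ ((s : ℝ) - 1) < 1 :=
      Real.rpow_lt_one_of_one_lt_of_neg (by norm_num) (by simpa using hs1)
    have hev : ∀ᶠ n : ℕ in atTop, (n : ℝ≥0) * 2⁻¹ ^ n ≤ ((2⁻¹ : ℝ≥0) ^ n) ^ (s : ℝ) := by
      have ht := tendsto_self_mul_const_pow_of_lt_one (Real.rpow_nonneg zero_le_two _) hlt
      filter_upwards [ht.eventually (ge_mem_nhds one_pos)] with n hn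
      rw [← NNReal.coe_le_coe]
      push_cast
      have h2 : ((2⁻¹ : ℝ) ^ n) ^ (s : ℝ) * ((2 : ℝ) ^ ((s : ℝ) - 1)) ^ n = 2⁻¹ ^ n := by
        rw [← Real.rpow_natCast, ← Real.rpow_natCast, Real.inv_rpow (by norm_num),
          Real.inv_rpow (by positivity), ← Real.rpow_mul (by norm_num),
          ← Real.rpow_mul (by norm_num), ← Real.rpow_neg (by norm_num), ← Real.rpow_neg (by norm_num),
          ← Real.rpow_add (by norm_num)]
        ring_nf
      calc (n : ℝ) * 2⁻¹ ^ n
          = ((2⁻¹ : ℝ) ^ n) ^ (s : ℝ) * (n * ((2 : ℝ) ^ ((s : ℝ) - 1)) ^ n) := by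
            rw [mul_left_comm, h2]
        _ ≤ ((2⁻¹ : ℝ) ^ n) ^ (s : ℝ) := mul_le_of_le_one_right (by positivity) hn
    obtain ⟨N, hN⟩ := eventually_atTop.1 (hDn.and hev)
    refine le_dimH_of_measure_cylinder_le hs0 (N := N) (fun n hn x => ?_) hμA
    refine (hμ x n).trans ?_
    rw [inv_two_pow_card_filter_notMem]
    refine ENNReal.coe_le_coe.2 (le_trans ?_ (hN n hn).2)
    gcongr
    exact_mod_cast (hN n hn).1
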